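/- Let $m\ge 0$ be an integer and $\alpha>-1$ real. Let $$L_n^{(\alpha)}(x)=\frac{(\alpha+1)_n}{n!}\sum_{k=0}^n\frac{(-n)_k}{k!\,(\alpha+1)_k}x^k,\qquad (a)_k=a(a+1)\cdots(a+k-1),$$ be the Laguerre polynomials, and for integers $n_0\ge 0$ and $\boldsymbol n=(n_1,\dots,n_m)$ with all $n_j\ge 0$ put $$A^{(\alpha)}(n_0,\boldsymbol n)=(-1)^{\sum_{j=1}^m n_j}\int_0^\infty x^{n_0}\,\frac{x^\alpha e^{-x}}{\Gamma(\alpha+1)}\prod_{j=1}^m n_j!\,L_{n_j}^{(\alpha)}(x)\,dx .$$ These integrals converge absolutely, and the following hold. (i) As formal power series in $x_0,x_1,\dots,x_m$ over $\mathbb R$, $$\sum_{n_0,\dots,n_m\ge 0}A^{(\alpha)}(n_0,\boldsymbol n)\frac{x_0^{n_0}}{n_0!}\cdots\frac{x_m^{n_m}}{n_m!}=\Bigl[1-x_0\prod_{j=1}^m(1+x_j)-\sum_{k=2}^m(k-1)\,e_k(x_1,\dots,x_m)\Bigr]^{-\alpha-1},$$ where $e_k$ is the $k$-th elementary symmetric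 polynomial and, for a power series $F$ with constant term $1$ and $r\in\mathbb R$, $F^{r}=\sum_{k\ge 0}\binom{r}{k}(F-1)^k$. (ii) Let $S_0,S_1,\dots,S_m$ be disjoint sets (boxes) with $|S_j|=n_j$ for $0\le j\le m$, and let $\mathfrak S^*(\boldsymbol n)$ be the set of permutations $\pi$ of $S_0\cup\cdots\cup S_m$ such that $\pi(S_j)\cap S_j=\emptyset$ for $1\le j\le m$ (no condition on the elements of $S_0$). Then, for all $n_0,n_1,\dots,n_m\ge 0$, $$A^{(\alpha)}(n_0,\boldsymbol n)=\sum_{\pi\in\mathfrak S^*(\boldsymbol n)}(\alpha+1)^{\operatorname{cyc}(\pi)},$$ where $\operatorname{cyc}(\pi)$ is the number of cycles of $\pi$, fixed points included. -/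

import Mathlib

open Finset MeasureTheory
open scoped Nat

noncomputable section

/-- The Laguerre polynomial
`L_n^{(α)}(x) = (α+1)_n / n! * ∑_{k=0}^n (-n)_k / (k! (α+1)_k) * x^k`, where `(a)_k` is the
shifted factorial `a (a+1) ⋯ (a+k-1)`. -/
def laguerre (α : ℝ) (n : ℕ) : Polynomial ℝ :=
  Polynomial.C ((ascPochhammer ℝ n).eval (α + 1) / (n ! : ℝ)) *
    ∑ k ∈ Finset.range (n + 1),
      Polynomial.C ((ascPochhammer ℝ k).eval (-(n : ℝ)) /
        ((k ! : ℝ) * (ascPochhammer ℝ k).eval (α + 1))) * Polynomial.X ^ k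

/-- The integrand `x^{n₀} * (x^α e^{-x} / Γ(α+1)) * ∏_j n_j! L_{n_j}^{(α)}(x)`. -/
def laguerreIntegrand {m : ℕ} (α : ℝ) (n₀ : ℕ) (n : Fin m → ℕ) (x : ℝ) : ℝ :=
  x ^ n₀ * (x ^ α * Real.exp (-x) / Real.Gamma (α + 1)) *
    ∏ j, (((n j) ! : ℕ) : ℝ) * (laguerre α (n j)).eval x

/-- The number
`A^{(α)}(n₀, n) = (-1)^{∑ n_j} ∫_0^∞ x^{n₀} (x^α e^{-x} / Γ(α+1)) ∏_j n_j! L_{n_j}^{(α)}(x) dx`. -/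
def laguerreNumber {m : ℕ} (α : ℝ) (n₀ : ℕ) (n : Fin m → ℕ) : ℝ :=
  (-1) ^ (∑ j, n j) * ∫ x in Set.Ioi (0 : ℝ), laguerreIntegrand α n₀ n x

/-- The exponential generating function of a family `a (n₀, n)`, as a formal power series in
`x_0, x_1, …, x_m`:  `∑ a (n₀, n) (x_0^{n₀} / n₀!) ∏_j (x_j^{n_j} / n_j!)`.
The variable `x_0` has index `0` and `x_j` (`1 ≤ j ≤ m`) has index `Fin.succ`. -/
def expGenFun {m : ℕ} (a : ℕ → (Fin m → ℕ) → ℝ) : MvPowerSeries (Fin (m + 1)) ℝ :=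
  fun d => a (d 0) (fun j => d j.succ) / ∏ i, (((d i) ! : ℕ) : ℝ)

/-- For a formal power series `F` with constant term `1` and real `r`, the formal power
`F ^ r = ∑_k binom(r, k) (F - 1)^k`: the binomial series `(1 + t)^r` at `t = F - 1`. -/
def formalRpow {σ : Type*} (F : MvPowerSeries σ ℝ) (r : ℝ) : MvPowerSeries σ ℝ :=
  (PowerSeries.binomialSeries ℝ r).subst (F - 1)

/-- The polynomial `1 - x_0 ∏_{j=1}^m (1 + x_j) - ∑_{k=2}^m (k - 1) e_k(x_1, …, x_m)`, with `e_k`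
the `k`-th elementary symmetric polynomial. -/
def basePoly (m : ℕ) : MvPolynomial (Fin (m + 1)) ℝ :=
  1 - MvPolynomial.X 0 * ∏ j : Fin m, (1 + MvPolynomial.X j.succ) -
    ∑ k ∈ Finset.Icc 2 m,
      MvPolynomial.C ((k : ℝ) - 1) * MvPolynomial.rename Fin.succ (MvPolynomial.esymm (Fin m) ℝ k)

/-- The disjoint union `S_0 ∪ S_1 ∪ ⋯ ∪ S_m` of boxes with `|S_0| = n₀` and `|S_j| = n_j`; an
element is a pair of a box index and a position in that box. -/
abbrev Boxes {m : ℕ} (n₀ : ℕ) (n : Fin m → ℕ) : Type :=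
  (i : Fin (m + 1)) × Fin ((Fin.cons n₀ n : Fin (m + 1) → ℕ) i)

/-- The set of permutations of `S_0 ∪ ⋯ ∪ S_m` that move every element of `S_1, …, S_m` out of its
box; elements of `S_0` are unrestricted. -/
def restrictedPerms {m : ℕ} (n₀ : ℕ) (n : Fin m → ℕ) : Finset (Equiv.Perm (Boxes n₀ n)) :=
  Finset.univ.filter fun π => ∀ b : Boxes n₀ n, b.1 ≠ 0 → (π b).1 ≠ b.1

/-- The number of cycles of a permutation (fixed points count as cycles). -/
def cyc {β : Type*} (π : Equiv.Perm β) : ℕ :=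
  Nat.card (Quotient (Equiv.Perm.SameCycle.setoid π))

/-- The base polynomial has constant term `1`, so that its formal real powers are meaningful. -/
theorem hasSubst_basePoly (m : ℕ) :
    PowerSeries.HasSubst ((basePoly m : MvPowerSeries (Fin (m + 1)) ℝ) - 1) := by
  apply PowerSeries.HasSubst.of_constantCoeff_zero
  have h : MvPolynomial.constantCoeff (basePoly m) = 1 := by
    unfold basePoly
    simp only [map_sub, map_one, map_mul, MvPolynomial.constantCoeff_X, zero_mul, sub_zero,
      map_sum, MvPolynomial.constantCoeff_rename]
    rw [sub_eq_self]
    refine Finset.sum_eq_zero fun k hk => ?_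
    rw [MvPolynomial.esymm, map_sum]
    refine mul_eq_zero_of_right _ (Finset.sum_eq_zero fun s hs => ?_)
    rw [map_prod]
    have hc : s.card = k := (Finset.mem_powersetCard.1 hs).2
    obtain ⟨i, hi⟩ : s.Nonempty := by
      rw [← Finset.card_pos]
      have := (Finset.mem_Icc.1 hk).1
      omega
    exact Finset.prod_eq_zero hi (by simp)
  rw [map_sub, map_one, ← MvPowerSeries.coeff_zero_eq_constantCoeff_apply, MvPolynomial.coeff_coe,
    ← MvPolynomial.constantCoeff_eq, h, sub_self]

end

/-!
The polynomials `(-1) ^ n * n! * L_n` are monic, and `A` is the linear functional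
`X ^ k ↦ (α + 1)_k`, which counts the permutations of a `k`-element set by cycles, applied to
`X ^ n₀` times their product.

For (ii), colour the elements by their boxes and mark those that have to change colour. Unmarking
one element `b` adds the permutations that keep the colour of `b`; deleting `b` from its cycle turns
them into permutations of the remaining elements, each obtained with weight `α + 1` (`b` was fixed)
plus `1` for every remaining element with the colour of `b` (the image of `b`). If every unmarked
element contributes a factor `X` and raises the parameter of its colour by one, this is matched by
`(-1) ^ (n + 1) * (n + 1)! * L_{n+1}^{(α)} = X M - (α + 1 + n) N`, where `M` and `N` are the monic
Laguerre polynomials of degree `n` with parameters `α + 1` and `α`.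

For (i), the base polynomial is `P = ∏ (1 + x_j) * (1 - x_0 - ∑ x_j / (1 + x_j))`, so that
`(1 + x_j)² ∂_j P = ∂_0 P + (1 + x_j) P`, and `G = P ^ (-α - 1)` satisfies
`(1 + x_j)² ∂_j G = ∂_0 G - (α + 1) (1 + x_j) G`. On coefficients this is the three-term recurrence
of the monic Laguerre polynomials, which reduces both sides of (i) to their values `(α + 1)_{n₀}`
at `n = 0`.
-/

section ShiftedFactorial

theorem ascPochhammer_eval_add_one_mul {R : Type*} [CommSemiring R] (n : ℕ) (a : R) :
    a * (ascPochhammer R n).eval (a + 1) = (ascPochhammer R n).eval a * (a + n) := by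
  rw [← ascPochhammer_succ_eval, ascPochhammer_succ_left]
  simp

theorem Gamma_add_natCast {b : ℝ} (hb : 0 < b) (k : ℕ) :
    Real.Gamma (b + k) = (ascPochhammer ℝ k).eval b * Real.Gamma b := by
  induction k with
  | zero => simp
  | succ k ih =>
    rw [Nat.cast_succ, ← add_assoc, Real.Gamma_add_one (by positivity), ih, ascPochhammer_succ_eval]
    ring

end ShiftedFactorial

section MonicLaguerre

open Polynomial

/-- The monic Laguerre polynomial `(-1)^n n! L_n^{(α)}`, the normalisation in which the factors of
`laguerreNumber` occur. -/
noncomputable def monicLaguerre (α : ℝ) (n : ℕ) : ℝ[X] :=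
  C ((-1) ^ n * (n ! : ℝ)) * laguerre α n

variable {α : ℝ}

theorem coeff_monicLaguerre (α : ℝ) (n k : ℕ) :
    (monicLaguerre α n).coeff k = (-1) ^ n * (ascPochhammer ℝ n).eval (α + 1) *
      ((ascPochhammer ℝ k).eval (-(n : ℝ)) / (k ! * (ascPochhammer ℝ k).eval (α + 1))) := by
  have hn : (n ! : ℝ) ≠ 0 := by positivity
  rw [monicLaguerre, laguerre, ← mul_assoc, ← C_mul, coeff_C_mul, finsetSum_coeff]
  simp only [coeff_C_mul_X_pow]
  rw [sum_ite_eq]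
  split_ifs with hk
  · field_simp
  · rw [ascPochhammer_eval_neg_coe_nat_of_lt (by simpa using hk)]
    simp

@[simp]
theorem monicLaguerre_zero (α : ℝ) : monicLaguerre α 0 = 1 := by
  simp [monicLaguerre, laguerre]

theorem monicLaguerre_succ (hα : -1 < α) (n : ℕ) :
    monicLaguerre α (n + 1) =
      X * monicLaguerre (α + 1) n - C (α + 1 + n) * monicLaguerre α n := by
  ext k
  have hβ : 0 < α + 1 := by linarith
  have hn := ascPochhammer_eval_add_one_mul n (α + 1)
  cases k with
  | zero =>
    simp only [coeff_sub, mul_coeff_zero, coeff_C_zero, coeff_X_zero, coeff_monicLaguerre,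
      ascPochhammer_zero, eval_one, ascPochhammer_succ_eval]
    ring
  | succ k =>
    have hk := ascPochhammer_eval_add_one_mul k (α + 1)
    have hnk := ascPochhammer_eval_add_one_mul k (-((n + 1 : ℕ) : ℝ))
    have hk₀ : (ascPochhammer ℝ k).eval (α + 1) ≠ 0 := (ascPochhammer_pos k _ hβ).ne'
    have hk₁ : (ascPochhammer ℝ k).eval (α + 1 + 1) ≠ 0 :=
      (ascPochhammer_pos k _ (by linarith)).ne'
    rw [show -((n + 1 : ℕ) : ℝ) + 1 = -n by push_cast; ring] at hnk
    simp only [coeff_sub, coeff_C_mul, coeff_X_mul, coeff_monicLaguerre,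
      ascPochhammer_succ_eval, ← hnk, ← hn, ← hk, Nat.factorial_succ]
    push_cast
    field_simp
    linear_combination ((-1) ^ n * (n - k) * (ascPochhammer ℝ k).eval (-(n : ℝ))) * hn

theorem monicLaguerre_succ_eq_add (hα : -1 < α) (n : ℕ) :
    monicLaguerre α (n + 1) =
      monicLaguerre (α + 1) (n + 1) + C (n + 1 : ℝ) * monicLaguerre (α + 1) n := by
  ext k
  have hβ : 0 < α + 1 := by linarith
  have hn := ascPochhammer_eval_add_one_mul n (α + 1)
  have hk := ascPochhammer_eval_add_one_mul k (α + 1)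
  have hnk := ascPochhammer_eval_add_one_mul k (-((n + 1 : ℕ) : ℝ))
  have hk₀ : (ascPochhammer ℝ k).eval (α + 1) ≠ 0 := (ascPochhammer_pos k _ hβ).ne'
  have hk₁ : (ascPochhammer ℝ k).eval (α + 1 + 1) ≠ 0 := (ascPochhammer_pos k _ (by linarith)).ne'
  rw [show -((n + 1 : ℕ) : ℝ) + 1 = -n by push_cast; ring] at hnk
  have hk' : (ascPochhammer ℝ k).eval (α + 1) =
      (α + 1) * (ascPochhammer ℝ k).eval (α + 1 + 1) / (α + 1 + k) := by
    rw [hk]; field_simp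
  simp only [coeff_add, coeff_C_mul, coeff_monicLaguerre, ascPochhammer_succ_eval, ← hn, hk']
  push_cast at hnk ⊢
  field_simp
  linear_combination ((-1) ^ n * (ascPochhammer ℝ n).eval (α + 1 + 1)) * hnk

theorem monicLaguerre_three_term (hα : -1 < α) (n : ℕ) :
    monicLaguerre α (n + 1) = X * monicLaguerre α n - C (2 * n + (α + 1)) * monicLaguerre α n -
      C (n * (n + α)) * monicLaguerre α (n - 1) := by
  cases n with
  | zero =>
    rw [monicLaguerre_succ hα]
    simp
  | succ n =>
    have h₁ := monicLaguerre_succ hα n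
    have h₂ := monicLaguerre_succ_eq_add hα n
    rw [monicLaguerre_succ hα (n + 1)]
    push_cast
    simp only [C_add, C_mul, map_ofNat, C_1] at h₁ h₂ ⊢
    linear_combination (-X) * h₂ + (C (n : ℝ) + 1) * h₁

end MonicLaguerre

section Moments

open Polynomial

/-- The linear functional `X ^ k ↦ (β)_k` on polynomials: integration against the density of the
Gamma distribution with shape parameter `β`, made purely algebraic. -/
noncomputable def momentFunctional {R : Type*} [CommSemiring R] (β : R) : R[X] →ₗ[R] R :=
  lsum fun k => LinearMap.toSpanSingleton R R ((ascPochhammer R k).eval β)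

theorem momentFunctional_monomial {R : Type*} [CommSemiring R] (β : R) (k : ℕ) (c : R) :
    momentFunctional β (monomial k c) = c * (ascPochhammer R k).eval β := by
  simp [momentFunctional, lsum_apply, sum_monomial_index]

theorem momentFunctional_X_pow {R : Type*} [CommSemiring R] (β : R) (k : ℕ) :
    momentFunctional β (X ^ k) = (ascPochhammer R k).eval β := by
  rw [X_pow_eq_monomial, momentFunctional_monomial, one_mul]

theorem momentFunctional_C_mul {R : Type*} [CommSemiring R] (β c : R) (p : R[X]) :
    momentFunctional β (C c * p) = c * momentFunctional β p := by
  rw [← smul_eq_C_mul, map_smul, smul_eq_mul]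

variable {α : ℝ}

theorem gammaWeight_mul_eval_monomial (k : ℕ) (c : ℝ) :
    Set.EqOn (fun x => x ^ α * Real.exp (-x) / Real.Gamma (α + 1) * (monomial k c).eval x)
      (fun x => c / Real.Gamma (α + 1) * (Real.exp (-x) * x ^ (α + 1 + k - 1))) (Set.Ioi 0) := by
  intro x (hx : 0 < x)
  simp only [eval_monomial, add_right_comm α 1, add_sub_cancel_right, Real.rpow_add hx,
    Real.rpow_natCast]
  ring

theorem integrableOn_gammaWeight_mul_eval (hα : -1 < α) (p : ℝ[X]) :
    IntegrableOn (fun x => x ^ α * Real.exp (-x) / Real.Gamma (α + 1) * p.eval x) (Set.Ioi 0) := by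
  have hβ : 0 < α + 1 := by linarith
  induction p using Polynomial.induction_on' with
  | add p q hp hq =>
    simp only [eval_add, mul_add]
    exact hp.add hq
  | monomial k c =>
    rw [integrableOn_congr_fun (gammaWeight_mul_eval_monomial k c) measurableSet_Ioi]
    exact (Real.GammaIntegral_convergent (by positivity)).const_mul _

theorem integral_gammaWeight_mul_eval (hα : -1 < α) (p : ℝ[X]) :
    ∫ x in Set.Ioi (0 : ℝ), x ^ α * Real.exp (-x) / Real.Gamma (α + 1) * p.eval x =
      momentFunctional (α + 1) p := by
  have hβ : 0 < α + 1 := by linarith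
  induction p using Polynomial.induction_on' with
  | add p q hp hq =>
    simp only [eval_add, mul_add]
    rw [integral_add (integrableOn_gammaWeight_mul_eval hα p)
      (integrableOn_gammaWeight_mul_eval hα q), hp, hq, map_add]
  | monomial k c =>
    have hΓ := (Real.Gamma_pos_of_pos hβ).ne'
    rw [setIntegral_congr_fun measurableSet_Ioi (gammaWeight_mul_eval_monomial k c),
      integral_const_mul, ← Real.Gamma_eq_integral (by positivity), Gamma_add_natCast hβ,
      momentFunctional_monomial]
    field_simp

variable {m : ℕ}

theorem laguerreIntegrand_eq_gammaWeight_mul_eval (n₀ : ℕ) (n : Fin m → ℕ) (x : ℝ) :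
    laguerreIntegrand α n₀ n x = x ^ α * Real.exp (-x) / Real.Gamma (α + 1) *
      (X ^ n₀ * ∏ j, C ((n j) ! : ℝ) * laguerre α (n j)).eval x := by
  simp only [laguerreIntegrand, eval_mul, eval_pow, eval_X, eval_prod, eval_C]
  ring

theorem integrableOn_laguerreIntegrand (hα : -1 < α) (n₀ : ℕ) (n : Fin m → ℕ) :
    IntegrableOn (laguerreIntegrand α n₀ n) (Set.Ioi 0) := by
  rw [funext (laguerreIntegrand_eq_gammaWeight_mul_eval n₀ n)]
  exact integrableOn_gammaWeight_mul_eval hα _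

theorem laguerreNumber_eq_momentFunctional (hα : -1 < α) (n₀ : ℕ) (n : Fin m → ℕ) :
    laguerreNumber α n₀ n =
      momentFunctional (α + 1) (X ^ n₀ * ∏ j, monicLaguerre α (n j)) := by
  simp only [laguerreNumber, laguerreIntegrand_eq_gammaWeight_mul_eval,
    integral_gammaWeight_mul_eval hα]
  rw [← momentFunctional_C_mul]
  simp only [monicLaguerre, C_mul, prod_mul_distrib, ← map_prod, prod_pow_eq_pow_sum]
  congr 1
  ring

theorem laguerreNumber_zero_right (hα : -1 < α) (n₀ : ℕ) :
    laguerreNumber α n₀ (0 : Fin m → ℕ) = (ascPochhammer ℝ n₀).eval (α + 1) := by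
  simp [laguerreNumber_eq_momentFunctional hα, momentFunctional_X_pow]

end Moments

section Cycles

open Equiv.Perm

variable {V W : Type*} {π : Equiv.Perm V} {ρ : Equiv.Perm W}

theorem sameCycle_map {f : V → W} (hf : ∀ u, ρ.SameCycle (f u) (f (π u))) {u v : V}
    (huv : π.SameCycle u v) : ρ.SameCycle (f u) (f v) := by
  obtain ⟨i, rfl⟩ := huv
  induction i using Int.induction_on with
  | zero => exact .refl _ _
  | succ k ih =>
    rw [add_comm, zpow_one_add, mul_apply]
    exact ih.trans (hf _)
  | pred k ih =>
    have hstep := hf ((π ^ (-(k : ℤ) - 1)) u)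
    rw [← mul_apply, ← zpow_one_add, add_sub_cancel] at hstep
    exact ih.trans hstep.symm

theorem cyc_eq_cyc_of_sameCycle (f : V → W) (g : W → V) (hf : ∀ u, ρ.SameCycle (f u) (f (π u)))
    (hg : ∀ w, π.SameCycle (g w) (g (ρ w))) (hgf : ∀ u, π.SameCycle (g (f u)) u)
    (hfg : ∀ w, ρ.SameCycle (f (g w)) w) : cyc π = cyc ρ :=
  Nat.card_congr
    { toFun := Quotient.map f fun _ _ => sameCycle_map hf
      invFun := Quotient.map g fun _ _ => sameCycle_map hg
      left_inv := Quotient.ind fun u => Quotient.sound (hgf u)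
      right_inv := Quotient.ind fun w => Quotient.sound (hfg w) }

theorem cyc_permCongr (e : V ≃ W) (π : Equiv.Perm V) : cyc (e.permCongr π) = cyc π :=
  cyc_eq_cyc_of_sameCycle e.symm e (fun _ => ⟨1, by simp⟩) (fun _ => ⟨1, by simp⟩)
    (fun _ => ⟨0, by simp⟩) (fun _ => ⟨0, by simp⟩)

theorem sameCycle_optionCongr_some {σ : Equiv.Perm V} {x y : V} :
    SameCycle σ.optionCongr (some x) (some y) ↔ σ.SameCycle x y := by
  refine ⟨fun h => ?_, sameCycle_map (f := some) fun u => ⟨1, by simp⟩⟩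
  refine sameCycle_map (f := fun u => u.getD x) (fun u => ?_) h
  cases u with
  | none => exact .refl _ _
  | some u => exact ⟨1, by simp⟩

theorem cyc_optionCongr [Finite V] (σ : Equiv.Perm V) :
    cyc (σ.optionCongr : Equiv.Perm (Option V)) = cyc σ + 1 := by
  let cycleOf : Option (Quotient (SameCycle.setoid σ)) →
      Quotient (SameCycle.setoid (σ.optionCongr : Equiv.Perm (Option V))) :=
    fun q => q.elim ⟦none⟧ (Quotient.map some fun _ _ => sameCycle_optionCongr_some.2)
  have hnone (x : V) : (⟦none⟧ : Quotient (SameCycle.setoid σ.optionCongr)) ≠ ⟦some x⟧ := fun h =>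
    Option.some_ne_none x ((Quotient.exact h : SameCycle _ _ _).eq_of_left rfl).symm
  have hinj : cycleOf.Injective := by
    rintro (_ | ⟨⟨x⟩⟩) (_ | ⟨⟨y⟩⟩) h
    · rfl
    · exact (hnone y h).elim
    · exact (hnone x h.symm).elim
    · exact congrArg some (Quotient.sound (sameCycle_optionCongr_some.1 (Quotient.exact h)))
  have hsurj : cycleOf.Surjective := by
    rintro ⟨_ | x⟩
    exacts [⟨none, rfl⟩, ⟨some ⟦x⟧, rfl⟩]
  rw [cyc, ← Nat.card_congr (Equiv.ofBijective cycleOf ⟨hinj, hsurj⟩), Finite.card_option, cyc]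

variable [DecidableEq V]

theorem decomposeOption_symm_apply_none (i : Option V) (σ : Equiv.Perm V) :
    decomposeOption.symm (i, σ) none = i := by
  simp

theorem decomposeOption_symm_apply_some (i : Option V) (σ : Equiv.Perm V) (x : V) :
    decomposeOption.symm (i, σ) (some x) = if some (σ x) = i then none else some (σ x) := by
  simp [Equiv.swap_apply_def]

theorem comp_decomposeOption_symm_apply_some {ι : Type*} {κ : Option V → ι} {i : Option V}
    (hi : κ i = κ none) (σ : Equiv.Perm V) (x : V) :
    κ (decomposeOption.symm (i, σ) (some x)) = κ (some (σ x)) := by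
  rw [decomposeOption_symm_apply_some]
  split_ifs with hx
  · rw [hx, hi]
  · rfl

theorem cyc_decomposeOption_symm_some (c : V) (σ : Equiv.Perm V) :
    cyc (decomposeOption.symm (some c, σ)) = cyc σ := by
  refine cyc_eq_cyc_of_sameCycle (fun u => u.getD c) some (fun u => ?_) (fun x => ?_) (fun u => ?_)
    (fun x => .refl _ _)
  · cases u with
    | none => simp [SameCycle.refl]
    | some x =>
      rw [decomposeOption_symm_apply_some]
      split_ifs with hx
      · exact ⟨1, by simpa using hx⟩
      · exact ⟨1, by simp⟩
  · by_cases hx : σ x = c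
    · exact ⟨2, by simp [zpow_ofNat, pow_two, hx]⟩
    · exact ⟨1, by simp [Equiv.swap_apply_def, hx]⟩
  · cases u with
    | none => exact SameCycle.symm ⟨1, by simp⟩
    | some x => exact .refl _ _

theorem pow_cyc_decomposeOption_symm {R : Type*} [Monoid R] [Finite V] (β : R) (i : Option V)
    (σ : Equiv.Perm V) :
    β ^ cyc (decomposeOption.symm (i, σ)) = i.elim β (fun _ => 1) * β ^ cyc σ := by
  cases i with
  | none =>
    have hnone : decomposeOption.symm (none, σ) = σ.optionCongr :=
      Equiv.ext fun _ => decomposeOption_symm_of_none_apply _ _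
    rw [hnone, cyc_optionCongr, pow_succ', Option.elim_none]
  | some c => rw [cyc_decomposeOption_symm_some, Option.elim_some, one_mul]

theorem sum_pow_cyc {R : Type*} [CommSemiring R] [Fintype V] (β : R) :
    ∑ π : Equiv.Perm V, β ^ cyc π = (ascPochhammer R (Fintype.card V)).eval β := by
  induction hN : Fintype.card V generalizing V with
  | zero =>
    have := Fintype.card_eq_zero_iff.1 hN
    simp [cyc]
  | succ N ih =>
    obtain ⟨b⟩ : Nonempty V := Fintype.card_pos_iff.1 (by lia)
    have hN' : Fintype.card {x // x ≠ b} = N := by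
      rw [Fintype.card_subtype_compl, hN, Fintype.card_unique, Nat.add_sub_cancel]
    rw [← (Equiv.optionSubtypeNe b).permCongr.sum_comp, ← decomposeOption.symm.sum_comp,
      Fintype.sum_prod_type]
    simp only [cyc_permCongr, pow_cyc_decomposeOption_symm, ← mul_sum, ← sum_mul, ih hN',
      Fintype.sum_option, Option.elim_none, Option.elim_some, sum_const, card_univ, hN']
    rw [ascPochhammer_succ_eval, nsmul_one, mul_comm]

end Cycles

section CycleSum

open Equiv.Perm

variable {R V W ι : Type*} [CommSemiring R] [Fintype V] [DecidableEq V] [Fintype W] [DecidableEq W]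
  [DecidableEq ι]

/-- The sum of `β ^ cyc π` over the permutations `π` of a set `V` coloured by `κ` that change the
colour of every element of `U`. -/
noncomputable def cycleSum (β : R) (κ : V → ι) (U : Finset V) : R :=
  ∑ π : Equiv.Perm V with ∀ b ∈ U, κ (π b) ≠ κ b, β ^ cyc π

theorem cycleSum_map (β : R) (e : V ≃ W) (κ : W → ι) (U : Finset V) :
    cycleSum β κ (U.map e.toEmbedding) = cycleSum β (κ ∘ e) U := by
  refine (sum_equiv e.permCongr (fun π => ?_) fun π _ => ?_).symm
  · simp only [mem_filter_univ, forall_mem_map]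
    simp
  · rw [cyc_permCongr]

theorem sum_pow_cyc_of_apply_none_eq (β : R) (κ : Option V → ι) (U : Finset V) :
    ∑ π : Equiv.Perm (Option V) with
        (∀ x ∈ U, κ (π (some x)) ≠ κ (some x)) ∧ κ (π none) = κ none, β ^ cyc π =
      (β + #{x | κ (some x) = κ none}) * cycleSum β (κ ∘ some) U := by
  have hweight : ∑ i : Option V with κ i = κ none, i.elim β (fun _ => 1) =
      β + #{x | κ (some x) = κ none} := by
    simp [sum_filter, Fintype.sum_option]
  rw [← hweight, cycleSum, sum_mul_sum, ← sum_product']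
  refine (sum_equiv decomposeOption.symm (fun p => ?_) fun p _ => ?_).symm
  · obtain ⟨i, σ⟩ := p
    simp only [mem_product, mem_filter_univ, decomposeOption_symm_apply_none, Function.comp_apply]
    rw [and_comm]
    refine and_congr_left fun hi => ?_
    simp only [comp_decomposeOption_symm_apply_some hi]
  · rw [pow_cyc_decomposeOption_symm]

theorem cycleSum_insertNone_add (β : R) (κ : Option V → ι) (U : Finset V) :
    cycleSum β κ (insertNone U) + (β + #{x | κ (some x) = κ none}) * cycleSum β (κ ∘ some) U =
      cycleSum β κ (U.map .some) := by
  rw [← sum_pow_cyc_of_apply_none_eq, add_comm]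
  simp only [cycleSum, forall_mem_insertNone, forall_mem_map, Function.Embedding.some_apply]
  rw [← sum_filter_add_sum_filter_not {π : Equiv.Perm (Option V) | ∀ x ∈ U,
    κ (π (some x)) ≠ κ (some x)} fun π => κ (π none) = κ none, filter_filter, filter_filter]
  simp only [and_comm, ne_eq]

theorem cycleSum_empty (β : R) (κ : V → ι) :
    cycleSum β κ ∅ = (ascPochhammer R (Fintype.card V)).eval β := by
  simp [cycleSum, sum_pow_cyc]

end CycleSum

section ColourPoly

open Polynomial

/-- The monic Laguerre polynomial of degree `n` with parameter `α + a`, multiplied by `X ^ a`: the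
factor contributed by a colour class with `n` marked and `a` unmarked elements. -/
noncomputable def shiftedLaguerre (α : ℝ) (a n : ℕ) : ℝ[X] :=
  X ^ a * monicLaguerre (α + a) n

variable {α : ℝ}

theorem shiftedLaguerre_zero_left (α : ℝ) (n : ℕ) : shiftedLaguerre α 0 n = monicLaguerre α n := by
  simp [shiftedLaguerre]

theorem shiftedLaguerre_zero_right (α : ℝ) (a : ℕ) : shiftedLaguerre α a 0 = X ^ a := by
  simp [shiftedLaguerre]

theorem shiftedLaguerre_succ (hα : -1 < α) (a n : ℕ) :
    shiftedLaguerre α a (n + 1) =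
      shiftedLaguerre α (a + 1) n - C (α + 1 + (n + a : ℕ)) * shiftedLaguerre α a n := by
  have hα' : -1 < α + a := by linarith [a.cast_nonneg (α := ℝ)]
  rw [shiftedLaguerre, shiftedLaguerre, shiftedLaguerre, monicLaguerre_succ hα', pow_succ,
    Nat.cast_succ, Nat.cast_add, ← add_assoc α, show α + a + 1 + (n : ℝ) = α + 1 + (n + a) by ring]
  ring

theorem card_filter_insertNone {V : Type*} (s : Finset V) (p : Option V → Prop) [DecidablePred p] :
    #{b ∈ insertNone s | p b} = #{x ∈ s | p (some x)} + if p none then 1 else 0 := by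
  rw [card_filter, sum_insertNone, card_filter, add_comm]

theorem card_filter_map_some {V : Type*} (s : Finset V) (p : Option V → Prop) [DecidablePred p] :
    #{b ∈ s.map .some | p b} = #{x ∈ s | p (some x)} := by
  rw [filter_map, card_map]
  rfl

variable {V W ι : Type*} [Fintype V] [DecidableEq V] [Fintype W] [DecidableEq W] [Fintype ι]
  [DecidableEq ι]

/-- The product over the colours `i` of `shiftedLaguerre`, with the numbers of elements of colour
`i` outside and inside the set `U` of marked elements. -/
noncomputable def colourPoly (α : ℝ) (κ : V → ι) (U : Finset V) : ℝ[X] :=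
  ∏ i, shiftedLaguerre α #{b ∈ Uᶜ | κ b = i} #{b ∈ U | κ b = i}

theorem colourPoly_map (α : ℝ) (e : V ≃ W) (κ : W → ι) (U : Finset V) :
    colourPoly α κ (U.map e.toEmbedding) = colourPoly α (κ ∘ e) U := by
  have hcompl : (U.map e.toEmbedding)ᶜ = Uᶜ.map e.toEmbedding := by
    ext; simp
  simp only [colourPoly, hcompl, filter_map, card_map]
  rfl

theorem colourPoly_empty (α : ℝ) (κ : V → ι) : colourPoly α κ ∅ = X ^ Fintype.card V := by
  simp only [colourPoly, compl_empty, filter_empty, card_empty, shiftedLaguerre_zero_right,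
    prod_pow_eq_pow_sum]
  rw [← card_univ, card_eq_sum_card_fiberwise fun b _ => mem_coe.2 (mem_univ (κ b))]

theorem colourPoly_insertNone (hα : -1 < α) (κ : Option V → ι) (U : Finset V) :
    colourPoly α κ (insertNone U) = colourPoly α κ (U.map .some) -
      C (α + 1 + #{x | κ (some x) = κ none}) * colourPoly α (κ ∘ some) U := by
  have hinsert : (insertNone U)ᶜ = Uᶜ.map .some := by ext (_ | x) <;> simp
  have hmap : (U.map .some)ᶜ = insertNone Uᶜ := by ext (_ | x) <;> simp
  have hcard : #{x | κ (some x) = κ none} =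
      #{x ∈ U | κ (some x) = κ none} + #{x ∈ Uᶜ | κ (some x) = κ none} := by
    rw [← card_union_of_disjoint (disjoint_filter_filter disjoint_compl_right), ← filter_union,
      union_compl]
  simp only [colourPoly, hinsert, hmap, card_filter_insertNone, card_filter_map_some,
    Function.comp_apply, ← mul_prod_erase univ _ (mem_univ (κ none))]
  have herase (f : ι → ℕ → ℝ[X]) : ∏ i ∈ univ.erase (κ none), f i (if κ none = i then 1 else 0) =
      ∏ i ∈ univ.erase (κ none), f i 0 :=
    prod_congr rfl fun i hi => by rw [if_neg (ne_of_mem_erase hi).symm]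
  rw [herase fun i c => shiftedLaguerre α _ (_ + c), herase fun i c => shiftedLaguerre α (_ + c) _,
    if_pos True.intro, shiftedLaguerre_succ hα, hcard]
  simp only [add_zero]
  ring

theorem cycleSum_eq_momentFunctional (hα : -1 < α) (κ : V → ι) (U : Finset V) :
    cycleSum (α + 1) κ U = momentFunctional (α + 1) (colourPoly α κ U) := by
  induction hN : #U generalizing V with
  | zero =>
    obtain rfl := card_eq_zero.1 hN
    rw [cycleSum_empty, colourPoly_empty, momentFunctional_X_pow]
  | succ N ih =>
    obtain ⟨b, hb⟩ : U.Nonempty := card_pos.1 (by lia)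
    obtain ⟨U', rfl⟩ : ∃ U' : Finset {x // x ≠ b},
        U = (insertNone U').map (Equiv.optionSubtypeNe b).toEmbedding :=
      ⟨U.subtype (· ≠ b), by ext x; by_cases x = b <;> simp_all⟩
    have hU' : #U' = N := by simpa using hN
    rw [cycleSum_map, colourPoly_map, colourPoly_insertNone hα, map_sub, momentFunctional_C_mul,
      ← ih _ _ hU', ← ih _ (U'.map .some) (by rw [card_map, hU']), ← cycleSum_insertNone_add,
      add_sub_cancel_right]

theorem laguerreNumber_eq_sum (hα : -1 < α) {m : ℕ} (n₀ : ℕ) (n : Fin m → ℕ) :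
    laguerreNumber α n₀ n = ∑ π ∈ restrictedPerms n₀ n, (α + 1) ^ cyc π := by
  have hperms : ∑ π ∈ restrictedPerms n₀ n, (α + 1) ^ cyc π =
      cycleSum (α + 1) (fun b : Boxes n₀ n => b.1) {b | b.1 ≠ 0} := by
    simp [restrictedPerms, cycleSum]
  rw [hperms, cycleSum_eq_momentFunctional hα, laguerreNumber_eq_momentFunctional hα, colourPoly,
    Fin.prod_univ_succ]
  have hbox (i : Fin (m + 1)) : #{b : Boxes n₀ n | b.1 = i} = (Fin.cons n₀ n : _ → ℕ) i := by
    rw [← Fintype.card_subtype, Fintype.card_congr (Equiv.sigmaSubtype i), Fintype.card_fin]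
  have hmarked (j : Fin m) (b : Boxes n₀ n) : b.1 ≠ 0 ∧ b.1 = j.succ ↔ b.1 = j.succ :=
    and_iff_right_of_imp fun hb => hb ▸ j.succ_ne_zero
  have hunmarked (j : Fin m) (b : Boxes n₀ n) : ¬(b.1 = 0 ∧ b.1 = j.succ) := fun hb =>
    j.succ_ne_zero (hb.2.symm.trans hb.1)
  simp only [compl_filter, filter_filter, not_not, and_self, not_and_self, hmarked, hunmarked,
    hbox, filter_false, card_empty, Fin.cons_zero, Fin.cons_succ, shiftedLaguerre_zero_left,
    shiftedLaguerre_zero_right]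

end ColourPoly

section ChainRule

open MvPowerSeries
open scoped PowerSeries

variable {σ R : Type*}

theorem coeff_pow_mul_eq_zero_of_constantCoeff_nilpotent [CommSemiring R]
    {g : MvPowerSeries σ R} {k : ℕ} (hg : constantCoeff g ^ k = 0) {d : σ →₀ ℕ} {n : ℕ}
    (hn : k + d.degree ≤ n) (h : MvPowerSeries σ R) : coeff d (g ^ n * h) = 0 := by
  classical
  refine (coeff_mul ..).trans (sum_eq_zero fun p hp => ?_)
  have hdeg : p.1.degree ≤ d.degree :=
    Finsupp.degree_mono ((self_le_add_right _ _).trans_eq (mem_antidiagonal.1 hp))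
  rw [coeff_eq_zero_of_constantCoeff_nilpotent hg (by lia), zero_mul]

variable [CommRing R] {g : MvPowerSeries σ R}

theorem pderiv_subst_coe (hg : PowerSeries.HasSubst g) (p : Polynomial R) (i : σ) :
    pderiv R i ((p : R⟦X⟧).subst g) =
      (PowerSeries.derivative R (p : R⟦X⟧)).subst g * pderiv R i g := by
  rw [PowerSeries.derivative_coe, PowerSeries.subst_coe hg, PowerSeries.subst_coe hg]
  exact Derivation.comp_aeval_eq g (pderiv R i) p

theorem pderiv_subst (hg : PowerSeries.HasSubst g) (f : R⟦X⟧) (i : σ) :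
    pderiv R i (f.subst g) = (PowerSeries.derivative R f).subst g * pderiv R i g := by
  ext d
  have hnil : IsNilpotent (constantCoeff g) := hg
  obtain ⟨k, hk⟩ := hnil
  let N := k + d.degree
  let h : R⟦X⟧ := .mk fun j => PowerSeries.coeff (j + N) f
  have hsplit : f = PowerSeries.X ^ N * h + (f.trunc N : R⟦X⟧) :=
    f.eq_X_pow_mul_shift_add_trunc N
  have htrunc := pderiv_subst_coe hg (f.trunc N) i
  have hpow := pderiv_subst_coe hg (Polynomial.X ^ N) i
  rw [← sub_eq_zero, ← map_sub, ← coeff_pow_mul_eq_zero_of_constantCoeff_nilpotent hk le_rfl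
    (pderiv R i (h.subst g) - (PowerSeries.derivative R h).subst g * pderiv R i g)]
  congr 1
  rw [hsplit]
  simp only [← PowerSeries.coe_substAlgHom hg, map_add, map_mul, map_pow, Derivation.leibniz,
    smul_eq_mul, Polynomial.coe_pow, Polynomial.coe_X, PowerSeries.substAlgHom_X] at htrunc hpow ⊢
  rw [htrunc, hpow]
  ring

end ChainRule

section PowerRule

open MvPowerSeries
open scoped PowerSeries

theorem one_add_X_mul_derivative_binomialSeries {R : Type*} [CommRing R] [BinomialRing R] (r : R) :
    (1 + PowerSeries.X) * PowerSeries.derivative R (PowerSeries.binomialSeries R r) =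
      r • PowerSeries.binomialSeries R r := by
  have hchoose (n : ℕ) : (n + 1 : R) * Ring.choose r (n + 1) = (r - n) * Ring.choose r n := by
    have h := Ring.choose_smul_choose r n.le_succ
    simpa [mul_comm] using h
  ext n
  cases n with
  | zero =>
    have h : PowerSeries.coeff 0 (PowerSeries.derivative R (PowerSeries.binomialSeries R r)) =
        r := by
      simp [PowerSeries.coeff_derivative]
    simpa [add_mul] using h
  | succ n =>
    have h := hchoose (n + 1)
    simp only [Nat.cast_add, Nat.cast_one, add_mul, one_mul, map_add, map_smul, smul_eq_mul,
      mul_one, PowerSeries.coeff_derivative, PowerSeries.binomialSeries_coeff,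
      PowerSeries.coeff_succ_X_mul] at h ⊢
    linear_combination h

variable {σ : Type*} {F : MvPowerSeries σ ℝ}

theorem mul_pderiv_formalRpow (hF : PowerSeries.HasSubst (F - 1)) (r : ℝ) (i : σ) :
    F * pderiv ℝ i (formalRpow F r) = C r * (formalRpow F r * pderiv ℝ i F) := by
  have hode := congrArg (PowerSeries.substAlgHom hF) (one_add_X_mul_derivative_binomialSeries r)
  rw [map_mul, map_add, map_one, map_smul, PowerSeries.substAlgHom_X, add_sub_cancel,
    PowerSeries.coe_substAlgHom] at hode
  rw [formalRpow, pderiv_subst hF, ← mul_assoc, hode, map_sub, pderiv_one, sub_zero,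
    smul_eq_C_mul, mul_assoc]

theorem constantCoeff_formalRpow (hF : constantCoeff F = 1) (r : ℝ) :
    constantCoeff (formalRpow F r) = 1 := by
  have hF' : constantCoeff (F - 1) = 0 := by rw [map_sub, hF, map_one, sub_self]
  have hsub := PowerSeries.HasSubst.of_constantCoeff_zero hF'
  have h := PowerSeries.constantCoeff_subst_eq_zero hF'
    (PowerSeries.binomialSeries ℝ r - 1) (by simp)
  rwa [← PowerSeries.coe_substAlgHom hsub, map_sub, map_one, map_sub, map_one, sub_eq_zero,
    PowerSeries.coe_substAlgHom] at h

end PowerRule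

section BasePolynomial

variable {ι R : Type*} [CommRing R]

/-- The sum of `(1 - |t|) ∏_{i ∈ t} x_i` over the subsets `t` of `s`; it equals
`∏ (1 + x_i) * (1 - ∑ x_i / (1 + x_i))` and is the part of `basePoly` that is free of `x_0`. -/
noncomputable def weightedSubsetSum (x : ι → R) (s : Finset ι) : R :=
  ∑ t ∈ s.powerset, (1 - (#t : R)) * ∏ i ∈ t, x i

theorem weightedSubsetSum_insert [DecidableEq ι] (x : ι → R) {s : Finset ι} {j : ι} (hj : j ∉ s) :
    weightedSubsetSum x (insert j s) =
      (1 + x j) * weightedSubsetSum x s - x j * ∏ i ∈ s, (1 + x i) := by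
  rw [weightedSubsetSum, sum_powerset_insert hj, prod_one_add, weightedSubsetSum, mul_sum, mul_sum,
    ← sum_sub_distrib, ← sum_add_distrib]
  refine sum_congr rfl fun t ht => ?_
  have hjt : j ∉ t := fun h => hj (mem_powerset.1 ht h)
  rw [card_insert_of_notMem hjt, prod_insert hjt]
  push_cast
  ring

theorem map_weightedSubsetSum {S : Type*} [CommRing S] (f : R →+* S) (x : ι → R) (s : Finset ι) :
    f (weightedSubsetSum x s) = weightedSubsetSum (fun i => f (x i)) s := by
  simp [weightedSubsetSum]

theorem weightedSubsetSum_zero (s : Finset ι) : weightedSubsetSum (0 : ι → R) s = 1 := by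
  classical
  induction s using Finset.induction_on with
  | empty => simp [weightedSubsetSum]
  | insert j s hj ih => simp [weightedSubsetSum_insert _ hj, ih]

section Derivation

variable {A : Type*} [CommRing A] [Algebra A R] (D : Derivation A R R) {x : ι → R} {s : Finset ι}

theorem derivation_prod_eq_zero (hx : ∀ i ∈ s, D (x i) = 0) : D (∏ i ∈ s, x i) = 0 :=
  prod_induction x (fun y => D y = 0) (fun y z hy hz => by simp [hy, hz])
    D.map_one_eq_zero hx

theorem derivation_prod_one_add_eq_zero (hx : ∀ i ∈ s, D (x i) = 0) :
    D (∏ i ∈ s, (1 + x i)) = 0 :=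
  derivation_prod_eq_zero D fun i hi => by simp [hx i hi]

theorem derivation_weightedSubsetSum_eq_zero (hx : ∀ i ∈ s, D (x i) = 0) :
    D (weightedSubsetSum x s) = 0 := by
  rw [weightedSubsetSum, map_sum]
  refine sum_eq_zero fun t ht => ?_
  have hprod := derivation_prod_eq_zero D fun i hi => hx i (mem_powerset.1 ht hi)
  simp [hprod]

end Derivation

open MvPolynomial

variable {m : ℕ}

theorem basePoly_eq_weightedSubsetSum : basePoly m =
    weightedSubsetSum (fun j : Fin m => X j.succ) univ - X 0 * ∏ j : Fin m, (1 + X j.succ) := by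
  have hesymm (k : ℕ) : ∑ t ∈ powersetCard k (univ : Finset (Fin m)),
      (1 - (#t : MvPolynomial (Fin (m + 1)) ℝ)) * ∏ i ∈ t, X i.succ =
      -(C ((k : ℝ) - 1) * rename Fin.succ (esymm (Fin m) ℝ k)) := by
    simp only [esymm, map_sum, map_prod, rename_X]
    rw [mul_sum, ← sum_neg_distrib]
    refine sum_congr rfl fun t ht => ?_
    rw [(mem_powersetCard.1 ht).2]
    simp only [map_sub, map_natCast, map_one]
    ring
  have hlow : ∑ k ∈ range (m + 1), C ((k : ℝ) - 1) * rename Fin.succ (esymm (Fin m) ℝ k) =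
      ∑ k ∈ Icc 2 m, C ((k : ℝ) - 1) * rename Fin.succ (esymm (Fin m) ℝ k) - 1 := by
    rw [sum_range_succ', ← Ico_add_one_right_eq_Icc, sum_Ico_eq_sum_range]
    rcases m with _ | m
    · simp
    · rw [sum_range_succ']
      simp [add_comm, add_left_comm, sub_eq_add_neg]
  rw [weightedSubsetSum, sum_powerset, sum_congr rfl fun k _ => hesymm k, sum_neg_distrib,
    card_fin, hlow, basePoly]
  ring

theorem pderiv_zero_basePoly :
    pderiv 0 (basePoly m) = -∏ j : Fin m, (1 + X j.succ) := by
  have hX (j : Fin m) : pderiv 0 (X j.succ : MvPolynomial (Fin (m + 1)) ℝ) = 0 :=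
    pderiv_X_of_ne j.succ_ne_zero
  have hw := derivation_weightedSubsetSum_eq_zero (s := univ) (pderiv (0 : Fin (m + 1)))
    fun j _ => hX j
  have hprod := derivation_prod_one_add_eq_zero (s := univ) (pderiv (0 : Fin (m + 1)))
    fun j _ => hX j
  simp [basePoly_eq_weightedSubsetSum, hw, hprod]

theorem pderiv_succ_basePoly (j : Fin m) :
    (1 + X j.succ) ^ 2 * pderiv j.succ (basePoly m) =
      pderiv 0 (basePoly m) + (1 + X j.succ) * basePoly m := by
  have hj := notMem_erase j univ
  have hX (i : Fin m) (hi : i ∈ univ.erase j) :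
      pderiv j.succ (X i.succ : MvPolynomial (Fin (m + 1)) ℝ) = 0 :=
    pderiv_X_of_ne ((Fin.succ_injective m).ne (ne_of_mem_erase hi))
  have hw := derivation_weightedSubsetSum_eq_zero (pderiv j.succ) hX
  have hprod := derivation_prod_one_add_eq_zero (pderiv j.succ) hX
  rw [pderiv_zero_basePoly, basePoly_eq_weightedSubsetSum, ← insert_erase (mem_univ j),
    weightedSubsetSum_insert _ hj, prod_insert hj]
  simp only [map_sub, map_add, Derivation.leibniz, hw, hprod, pderiv_X_self,
    Derivation.map_one_eq_zero, pderiv_X_of_ne j.succ_ne_zero.symm, smul_eq_mul]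
  ring

theorem map_basePoly_of_map_X_succ_eq_zero {S : Type*} [CommRing S]
    (f : MvPolynomial (Fin (m + 1)) ℝ →+* S) (hf : ∀ j : Fin m, f (X j.succ) = 0) :
    f (basePoly m) = 1 - f (X 0) := by
  have hw : f (weightedSubsetSum (fun j : Fin m => X j.succ) univ) = 1 := by
    rw [map_weightedSubsetSum, ← weightedSubsetSum_zero (R := S) (univ : Finset (Fin m))]
    simp only [hf, Pi.zero_def]
  simp [basePoly_eq_weightedSubsetSum, hw, hf]

end BasePolynomial

section ExponentialCoefficients

open MvPowerSeries

variable {σ R : Type*} [Fintype σ] [CommSemiring R]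

/-- The coefficients of a power series read as an exponential generating function:
`F = ∑ expCoeff F d * ∏ x_i ^ d i / (d i)!`. -/
noncomputable def expCoeff : MvPowerSeries σ R →ₗ[R] (σ →₀ ℕ) → R :=
  LinearMap.pi fun d => ((∏ i, (d i)! : ℕ) : R) • coeff d

theorem expCoeff_apply (F : MvPowerSeries σ R) (d : σ →₀ ℕ) :
    expCoeff F d = (∏ i, (d i)! : ℕ) * coeff d F := rfl

theorem prod_factorial_add_single (d : σ →₀ ℕ) (i : σ) :
    ∏ k, ((d + Finsupp.single i 1 : σ →₀ ℕ) k)! = (d i + 1) * ∏ k, (d k)! := by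
  classical
  rw [← mul_prod_erase _ _ (mem_univ i), ← mul_prod_erase univ (fun k => (d k)!) (mem_univ i),
    ← mul_assoc]
  congr 1
  · simp [Nat.factorial_succ]
  · refine prod_congr rfl fun k hk => ?_
    simp [Finsupp.single_eq_of_ne (ne_of_mem_erase hk)]

theorem expCoeff_pderiv (F : MvPowerSeries σ R) (i : σ) (d : σ →₀ ℕ) :
    expCoeff (pderiv R i F) d = expCoeff F (d + Finsupp.single i 1) := by
  rw [expCoeff_apply, expCoeff_apply, prod_factorial_add_single, coeff_pderiv]
  push_cast
  ring

theorem expCoeff_X_mul (F : MvPowerSeries σ R) (i : σ) (d : σ →₀ ℕ) :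
    expCoeff (X i * F) d = d i * expCoeff F (d - Finsupp.single i 1) := by
  classical
  by_cases hd : Finsupp.single i 1 ≤ d
  · obtain ⟨d, rfl⟩ := (⟨d - Finsupp.single i 1, (tsub_add_cancel_of_le hd).symm⟩ :
      ∃ d', d = d' + Finsupp.single i 1)
    rw [expCoeff_apply, expCoeff_apply, prod_factorial_add_single, add_tsub_cancel_right,
      add_comm d, X, coeff_add_monomial_mul]
    simp [mul_assoc, add_comm (1 : R)]
  · have hi : d i = 0 := by simpa [Finsupp.single_le_iff, Nat.one_le_iff_ne_zero] using hd
    rw [expCoeff_apply, X, coeff_monomial_mul, if_neg hd, hi, mul_zero, Nat.cast_zero, zero_mul]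

theorem expCoeff_X_mul_pderiv (F : MvPowerSeries σ R) (i : σ) (d : σ →₀ ℕ) :
    expCoeff (X i * pderiv R i F) d = d i * expCoeff F d := by
  rw [expCoeff_X_mul, expCoeff_pderiv]
  rcases Nat.eq_zero_or_pos (d i) with hd | hd
  · simp [hd]
  · rw [tsub_add_cancel_of_le (Finsupp.single_le_iff.2 hd)]

theorem expCoeff_X_mul_X_mul_pderiv (F : MvPowerSeries σ R) (i : σ) (d : σ →₀ ℕ) :
    expCoeff (X i * (X i * pderiv R i F)) d =
      d i * ((d i - 1 : ℕ) * expCoeff F (d - Finsupp.single i 1)) := by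
  rw [expCoeff_X_mul, expCoeff_X_mul_pderiv, Finsupp.tsub_apply, Finsupp.single_eq_same]

theorem expCoeff_injective [IsDomain R] [CharZero R] :
    Function.Injective (expCoeff (σ := σ) (R := R)) := by
  intro F G h
  ext d
  have hd : ((∏ i, (d i)! : ℕ) : R) ≠ 0 :=
    Nat.cast_ne_zero.2 (prod_ne_zero_iff.2 fun i _ => (d i).factorial_ne_zero)
  exact mul_left_cancel₀ hd (congrFun h d)

theorem expCoeff_expGenFun {m : ℕ} (a : ℕ → (Fin m → ℕ) → ℝ) (d : Fin (m + 1) →₀ ℕ) :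
    expCoeff (expGenFun a) d = a (d 0) (fun j => d j.succ) := by
  have hd : (∏ i, ((d i)! : ℝ)) ≠ 0 :=
    prod_ne_zero_iff.2 fun i _ => Nat.cast_ne_zero.2 (d i).factorial_ne_zero
  rw [expCoeff_apply, Nat.cast_prod]
  exact mul_div_cancel₀ _ hd

end ExponentialCoefficients

section LaguerreRecurrence

variable {m : ℕ} {R : Type*} [CommRing R] {β : R}

/-- The recurrence satisfied by the numbers `A^{(β - 1)}(d_0, (d_1, …, d_m))`; it is the three-term
recurrence of the monic Laguerre polynomials applied to the `j`-th factor. -/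
def IsLaguerreRecurrence (β : R) (a : (Fin (m + 1) →₀ ℕ) → R) : Prop :=
  ∀ (j : Fin m) (d : Fin (m + 1) →₀ ℕ),
    a (d + Finsupp.single j.succ 1) = a (d + Finsupp.single 0 1) - (2 * d j.succ + β) * a d -
      d j.succ * (d j.succ - 1 + β) * a (d - Finsupp.single j.succ 1)

theorem IsLaguerreRecurrence.ext {a b : (Fin (m + 1) →₀ ℕ) → R}
    (ha : IsLaguerreRecurrence β a) (hb : IsLaguerreRecurrence β b)
    (h : ∀ n, a (Finsupp.single 0 n) = b (Finsupp.single 0 n)) : a = b := by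
  suffices ∀ (N : ℕ) (d : Fin (m + 1) →₀ ℕ), ∑ j : Fin m, d j.succ ≤ N → a d = b d from
    funext fun d => this _ d le_rfl
  intro N
  induction N with
  | zero =>
    intro d hd
    have haxis : d = Finsupp.single 0 (d 0) := by
      ext i
      refine Fin.cases (by simp) (fun j => ?_) i
      simpa using sum_eq_zero_iff.1 (Nat.le_zero.1 hd) j (mem_univ j)
    rw [haxis, h]
  | succ N ih =>
    intro d hd
    by_cases hle : ∑ j : Fin m, d j.succ ≤ N
    · exact ih d hle
    obtain ⟨j, -, hj⟩ := exists_ne_zero_of_sum_ne_zero (show ∑ j : Fin m, d j.succ ≠ 0 by lia)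
    obtain ⟨d, rfl⟩ : ∃ d', d = d' + Finsupp.single j.succ 1 :=
      ⟨d - Finsupp.single j.succ 1, (tsub_add_cancel_of_le
        (Finsupp.single_le_iff.2 (Nat.one_le_iff_ne_zero.2 hj))).symm⟩
    have hN : ∑ i : Fin m, d i.succ ≤ N := by
      simpa [sum_add_distrib, Finsupp.single_apply] using hd
    have hN' : ∑ i : Fin m, (d - Finsupp.single j.succ 1 : Fin (m + 1) →₀ ℕ) i.succ ≤ N :=
      (sum_le_sum fun i _ => tsub_le_self).trans hN
    rw [ha, hb, ih d hN, ih _ hN', ih (d + Finsupp.single 0 1)]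
    simpa [Finsupp.single_apply, (Fin.succ_ne_zero _).symm] using hN

open MvPowerSeries

theorem isLaguerreRecurrence_expCoeff {G : MvPowerSeries (Fin (m + 1)) R}
    (hG : ∀ j : Fin m, (1 + X j.succ) ^ 2 * pderiv R j.succ G =
      pderiv R 0 G - C β * ((1 + X j.succ) * G)) :
    IsLaguerreRecurrence β (expCoeff G) := by
  intro j d
  have h := congrArg (expCoeff · d) (hG j)
  have hexpand : (1 + X j.succ : MvPowerSeries (Fin (m + 1)) R) ^ 2 * pderiv R j.succ G =
      pderiv R j.succ G + (2 : R) • (X j.succ * pderiv R j.succ G) +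
        X j.succ * (X j.succ * pderiv R j.succ G) := by
    rw [two_smul]
    ring
  have hpred : (d j.succ : R) * ((d j.succ - 1 : ℕ) : R) = d j.succ * (d j.succ - 1) := by
    cases d j.succ <;> simp
  simp only [hexpand, ← smul_eq_C_mul, add_mul, one_mul, map_add, map_sub, map_smul, Pi.add_apply,
    Pi.sub_apply, Pi.smul_apply, smul_eq_mul, expCoeff_X_mul_X_mul_pderiv, expCoeff_X_mul_pderiv,
    expCoeff_X_mul G, expCoeff_pderiv] at h
  linear_combination h - expCoeff G (d - Finsupp.single j.succ 1) * hpred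

theorem isLaguerreRecurrence_laguerreNumber {α : ℝ} (hα : -1 < α) :
    IsLaguerreRecurrence (m := m) (α + 1)
      (fun d => laguerreNumber α (d 0) fun j => d j.succ) := by
  intro j d
  let Q : Polynomial ℝ := ∏ i ∈ univ.erase j, monicLaguerre α (d i.succ)
  have hQ (d' : Fin (m + 1) →₀ ℕ) (hd' : ∀ i ≠ j, d' i.succ = d i.succ) :
      laguerreNumber α (d' 0) (fun i => d' i.succ) =
        momentFunctional (α + 1) (Polynomial.X ^ d' 0 * (monicLaguerre α (d' j.succ) * Q)) := by
    rw [laguerreNumber_eq_momentFunctional hα, ← mul_prod_erase _ _ (mem_univ j),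
      prod_congr rfl fun i hi => by rw [hd' i (ne_of_mem_erase hi)]]
  have hsingle (i : Fin m) (hi : i ≠ j) : Finsupp.single j.succ 1 i.succ = 0 :=
    Finsupp.single_eq_of_ne ((Fin.succ_injective m).ne hi)
  beta_reduce
  rw [hQ (d + Finsupp.single j.succ 1) fun i hi => by simp [hsingle i hi],
    hQ (d - Finsupp.single j.succ 1) fun i hi => by simp [hsingle i hi],
    hQ (d + Finsupp.single 0 1) fun i _ => by simp, hQ d fun _ _ => rfl]
  have h0 : Finsupp.single j.succ 1 (0 : Fin (m + 1)) = 0 :=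
    Finsupp.single_eq_of_ne j.succ_ne_zero.symm
  have hj : Finsupp.single (0 : Fin (m + 1)) 1 j.succ = 0 :=
    Finsupp.single_eq_of_ne j.succ_ne_zero
  simp only [Finsupp.add_apply, Finsupp.tsub_apply, Finsupp.single_eq_same, h0, hj, add_zero,
    tsub_zero]
  rw [monicLaguerre_three_term hα, ← momentFunctional_C_mul, ← momentFunctional_C_mul, ← map_sub,
    ← map_sub]
  congr 1
  rw [show (d j.succ - 1 + (α + 1) : ℝ) = d j.succ + α by ring]
  ring

end LaguerreRecurrence

section Axis

open MvPowerSeries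

variable {m : ℕ} {R : Type*} [CommSemiring R]

/-- Restriction of a power series to the `x_0`-axis: all the other variables are set to `0`. -/
noncomputable def axisRestrict :
    MvPowerSeries (Fin (m + 1)) R →ₐ[R] PowerSeries R :=
  killCompl (Function.Embedding.punit 0)

theorem coeff_axisRestrict (F : MvPowerSeries (Fin (m + 1)) R) (n : ℕ) :
    PowerSeries.coeff n (axisRestrict F) = coeff (Finsupp.single 0 n) F := by
  rw [PowerSeries.coeff, axisRestrict, coeff_killCompl, Finsupp.embDomain_single]
  rfl

theorem axisRestrict_X_succ (j : Fin m) :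
    axisRestrict (X j.succ : MvPowerSeries (Fin (m + 1)) R) = 0 :=
  killCompl_X_eq_zero fun ⟨_, h⟩ => j.succ_ne_zero h.symm

theorem axisRestrict_X_zero :
    axisRestrict (X 0 : MvPowerSeries (Fin (m + 1)) R) = PowerSeries.X :=
  killCompl_X (e := Function.Embedding.punit (0 : Fin (m + 1))) PUnit.unit

theorem axisRestrict_pderiv_zero (F : MvPowerSeries (Fin (m + 1)) R) :
    axisRestrict (pderiv R 0 F) = PowerSeries.derivative R (axisRestrict F) := by
  ext n
  rw [coeff_axisRestrict, coeff_pderiv, PowerSeries.coeff_derivative, coeff_axisRestrict,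
    ← Finsupp.single_add, Finsupp.single_eq_same]

end Axis

section GeneratingFunction

open MvPowerSeries

variable {m : ℕ}

theorem constantCoeff_basePoly :
    constantCoeff (basePoly m : MvPowerSeries (Fin (m + 1)) ℝ) = 1 := by
  have h : IsNilpotent (constantCoeff ((basePoly m : MvPowerSeries (Fin (m + 1)) ℝ) - 1)) :=
    hasSubst_basePoly m
  rwa [isNilpotent_iff_eq_zero, map_sub, map_one, sub_eq_zero] at h

theorem isLaguerreRecurrence_expCoeff_formalRpow_basePoly (β : ℝ) :
    IsLaguerreRecurrence β (expCoeff
      (formalRpow (basePoly m : MvPowerSeries (Fin (m + 1)) ℝ) (-β))) := by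
  refine isLaguerreRecurrence_expCoeff fun j => ?_
  have hP := congrArg (MvPolynomial.toMvPowerSeries) (pderiv_succ_basePoly j)
  simp only [MvPolynomial.coe_mul, MvPolynomial.coe_add, MvPolynomial.coe_pow, MvPolynomial.coe_one,
    MvPolynomial.coe_X, ← pderiv_coe] at hP
  have hne : (basePoly m : MvPowerSeries (Fin (m + 1)) ℝ) ≠ 0 :=
    ne_zero_of_map (f := constantCoeff) (by rw [constantCoeff_basePoly]; exact one_ne_zero)
  have hj := mul_pderiv_formalRpow (hasSubst_basePoly m) (-β) j.succ
  have h0 := mul_pderiv_formalRpow (hasSubst_basePoly m) (-β) 0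
  refine mul_left_cancel₀ hne ?_
  rw [map_neg] at hj h0
  linear_combination (1 + X j.succ) ^ 2 * hj - h0 - C β *
    formalRpow (basePoly m : MvPowerSeries (Fin (m + 1)) ℝ) (-β) * hP

theorem axisRestrict_basePoly :
    axisRestrict (basePoly m : MvPowerSeries (Fin (m + 1)) ℝ) = 1 - PowerSeries.X := by
  have h := map_basePoly_of_map_X_succ_eq_zero (m := m)
    ((axisRestrict : _ →ₐ[ℝ] PowerSeries ℝ).toRingHom.comp MvPolynomial.coeToMvPowerSeries.ringHom)
    fun j => by simpa using axisRestrict_X_succ j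
  simpa [axisRestrict_X_zero] using h

theorem factorial_mul_coeff_of_one_sub_X_mul_derivative_eq {R : Type*} [CommRing R] {β : R}
    {g : PowerSeries R} (h₀ : PowerSeries.constantCoeff g = 1)
    (hg : (1 - PowerSeries.X) * PowerSeries.derivative R g = PowerSeries.C β * g) (n : ℕ) :
    (n ! : R) * PowerSeries.coeff n g = (ascPochhammer R n).eval β := by
  have hsucc (n : ℕ) :
      PowerSeries.coeff (n + 1) g * (n + 1) = (β + n) * PowerSeries.coeff n g := by
    have h := congrArg (PowerSeries.coeff n) hg
    rw [sub_mul, one_mul, map_sub, PowerSeries.coeff_C_mul, PowerSeries.coeff_derivative] at h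
    cases n with
    | zero => simpa using h
    | succ n =>
      rw [PowerSeries.coeff_succ_X_mul, PowerSeries.coeff_derivative] at h
      push_cast at h ⊢
      linear_combination h
  induction n with
  | zero => simpa using h₀
  | succ n ih =>
    rw [ascPochhammer_succ_eval, ← ih, Nat.factorial_succ]
    push_cast
    linear_combination (n ! : R) * hsucc n

theorem expCoeff_single_formalRpow_basePoly (β : ℝ) (n : ℕ) :
    expCoeff (formalRpow (basePoly m : MvPowerSeries (Fin (m + 1)) ℝ) (-β)) (Finsupp.single 0 n) =
      (ascPochhammer ℝ n).eval β := by
  let g := axisRestrict (formalRpow (basePoly m : MvPowerSeries (Fin (m + 1)) ℝ) (-β))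
  have hode : (1 - PowerSeries.X) * PowerSeries.derivative ℝ g = PowerSeries.C β * g := by
    have hC : axisRestrict (C (-β) : MvPowerSeries (Fin (m + 1)) ℝ) = PowerSeries.C (-β) :=
      AlgHom.commutes axisRestrict (-β)
    have h := congrArg axisRestrict (mul_pderiv_formalRpow (hasSubst_basePoly m) (-β) 0)
    rw [map_mul, map_mul, map_mul, axisRestrict_pderiv_zero, axisRestrict_pderiv_zero,
      axisRestrict_basePoly, map_sub, PowerSeries.derivative_X, Derivation.map_one_eq_zero, hC,
      map_neg] at h
    linear_combination h
  have hconst : PowerSeries.constantCoeff g = 1 := by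
    rw [← PowerSeries.coeff_zero_eq_constantCoeff_apply, coeff_axisRestrict, Finsupp.single_zero,
      coeff_zero_eq_constantCoeff_apply, constantCoeff_formalRpow constantCoeff_basePoly]
  have hfact : ∏ i, ((Finsupp.single (0 : Fin (m + 1)) n : Fin (m + 1) →₀ ℕ) i)! = n ! := by
    simp [Fin.prod_univ_succ]
  rw [expCoeff_apply, hfact, ← coeff_axisRestrict,
    factorial_mul_coeff_of_one_sub_X_mul_derivative_eq hconst hode]

theorem expGenFun_laguerreNumber {α : ℝ} (hα : -1 < α) :
    expGenFun (m := m) (laguerreNumber α) =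
      formalRpow (basePoly m : MvPowerSeries (Fin (m + 1)) ℝ) (-α - 1) := by
  have hcoeff : expCoeff (expGenFun (m := m) (laguerreNumber α)) =
      fun d => laguerreNumber α (d 0) fun j => d j.succ := funext (expCoeff_expGenFun _)
  have haxis (n : ℕ) : (fun j : Fin m => Finsupp.single (0 : Fin (m + 1)) n j.succ) = 0 :=
    funext fun j => Finsupp.single_eq_of_ne j.succ_ne_zero
  rw [← neg_add']
  refine expCoeff_injective (hcoeff.trans ?_)
  refine (isLaguerreRecurrence_laguerreNumber hα).ext
    (isLaguerreRecurrence_expCoeff_formalRpow_basePoly (α + 1)) fun n => ?_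
  rw [expCoeff_single_formalRpow_basePoly, haxis, Finsupp.single_eq_same,
    laguerreNumber_zero_right hα]

end GeneratingFunction

theorem mainTheorem8 (m : ℕ) (α : ℝ) (hα : -1 < α) :
    (∀ (n₀ : ℕ) (n : Fin m → ℕ),
      IntegrableOn (laguerreIntegrand α n₀ n) (Set.Ioi (0 : ℝ))) ∧
    expGenFun (m := m) (laguerreNumber α) =
      formalRpow (basePoly m : MvPowerSeries (Fin (m + 1)) ℝ) (-α - 1) ∧
    (∀ (n₀ : ℕ) (n : Fin m → ℕ),
      laguerreNumber α n₀ n = ∑ π ∈ restrictedPerms n₀ n, (α + 1) ^ cyc π) :=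
  ⟨integrableOn_laguerreIntegrand hα, expGenFun_laguerreNumber hα, laguerreNumber_eq_sum hα⟩
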